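/- An *ultraposet* is a poset $P$ together with, for every set $S$, a map $(f,\mu)\mapsto\langle f,\mu\rangle$, $P^S\times\beta S\to P$ (where $\beta S$ is the set of ultrafilters on $S$), which is monotone in $f$ and satisfies: - (unity) $\langle f,\delta_s\rangle=f(s)$ for the principal ultrafilter $\delta_s$ at $s\in S$; - (lax associativity) for $f:S\to P$, $\mu:T\to\beta S$ and $\nu\in\beta T$, $\langle f,\langle\mu,\nu\rangle\rangle\le\langle t\mapsto\langle f,\mu_t\rangle,\nu\rangle$, where $A\in\langle\mu,\nu\rangle\iff\{t\mid A\in\mu_t\}\in\nu$; - (locality) $\langle f,i_*\nu\rangle=\langle f\circ i,\nu\rangle$ for every injection $i:W\to S$ and $\nu\in\beta W$, where $i_*\nu$ is the pushforward. A *left ultrafunctor* $P\to Q$ is a monotone map $\varphi$ such that $\varphi\langle f,\mu\rangle\le\langle\varphi f,\mu\rangle$ for all $S$, $f:S\to P$, $\mu\in\beta S$. Let $\mathbf{UltLPos}$ be the category of ultraposets and left ultrafunctors, with morphisms ordered pointwise. The poset $\mathbf 2=\{0<1\}$ is an ultraposet with $\langle f,\mu\rangle=i\iff f^{-1}(i)\in\mu$.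 Let $\mathbf{Loc}$ be the category of locales, with localic maps ordered by the pointwise order of their inverse images $g^*$, and let $\mathbf{CLoc}$ be its full subcategory of coherent locales, i.e. those in which every element is a join of finite (compact) elements and the finite elements form a sublattice (including the top and bottom elements). Let $\Omega:\mathbf{UltLPos}\to\mathbf{Loc}$ be the functor sending $P$ to the frame of left ultrafunctors $P\to\mathbf 2$, ordered pointwise, and sending $\varphi$ to the localic map whose inverse image is precomposition with $\varphi$. Let $\mathrm{pt}:\mathbf{CLoc}\to\mathbf{UltLPos}$ be the functor sending $L$ to its poset of points (frame homomorphisms $x:L\to\mathbf 2$, ordered pointwise), with the ultrastructure determined by $\langle f,\mu\rangle(k)=1\iff\{s\mid f(s)(k)=1\}\in\mu$ for every finite element $k\in L$, and sending $g$ to precomposition with $g^*$. Let $\mathbf{CUltLPos}$ be the full subcategory of $\mathbf{UltLPos}$ on the essential image of $\mathrm{pt}$. **Theorem.** 1. $\Omega(P)$ is coherent for every $P$ in $\mathbf{CUltLPos}$, and $\mathrm{pt}$ and $\Omega$ restrict to functors $\mathbf{CLoc}\to\mathbf{CUltLPos}$ and $\mathbf{CUltLPos}\to\mathbf{CLoc}$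 which form an equivalence of categories $\mathbf{CLoc}\simeq\mathbf{CUltLPos}$. 2. In particular, $\mathrm{pt}:\mathbf{CLoc}\to\mathbf{UltLPos}$ is fully faithful; moreover, for all $g,h:L\to M$ in $\mathbf{CLoc}$, $g\le h$ if and only if $\mathrm{pt}(g)\le\mathrm{pt}(h)$. 3. For every ultraposet $P$ and every coherent locale $L$ there is an isomorphism of posets $$\mathbf{UltLPos}(P,\mathrm{pt}(L))\cong\mathbf{Loc}(\Omega(P),L),$$ natural in $P\in\mathbf{UltLPos}$ and $L\in\mathbf{CLoc}$. -/

import Mathlib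

open CategoryTheory

universe u

/-- An ultraposet: a poset `P` with, for every set `S`, a monotone ultraproduct operation
`ult : P^S × βS → P`; the pairing `P^S × (βS)^T → P^T` is its pointwise extension in the second
variable. Here `pure s` is the principal ultrafilter at `s`, `ν.map i` is the pushforward of `ν`
along `i`, and `ν.bind μ` is the Kleisli pairing, `A ∈ ν.bind μ ↔ {t | A ∈ μ t} ∈ ν`. -/
class UltraPoset (P : Type u) extends PartialOrder P where
  /-- the ultraproduct of a family along an ultrafilter -/
  ult : ∀ {S : Type u}, (S → P) → Ultrafilter S → P
  ult_mono : ∀ {S : Type u} (f g : S → P) (μ : Ultrafilter S), f ≤ g → ult f μ ≤ ult g μ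
  /-- unity -/
  ult_pure : ∀ {S : Type u} (f : S → P) (s : S), ult f (pure s) = f s
  /-- lax associativity -/
  ult_bind_le : ∀ {S T : Type u} (f : S → P) (μ : T → Ultrafilter S) (ν : Ultrafilter T),
    ult f (ν.bind μ) ≤ ult (fun t => ult f (μ t)) ν
  /-- locality -/
  ult_map : ∀ {S W : Type u} (f : S → P) (i : W → S) (ν : Ultrafilter W),
    Function.Injective i → ult f (ν.map i) = ult (f ∘ i) ν

open UltraPoset

/-- A left ultrafunctor: a monotone map with `φ ⟨f, μ⟩ ≤ ⟨φ ∘ f, μ⟩`. -/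
@[ext]
structure LeftUltrafunctor (P Q : Type u) [UltraPoset P] [UltraPoset Q] where
  toFun : P → Q
  monotone' : Monotone toFun
  map_ult_le' : ∀ {S : Type u} (f : S → P) (μ : Ultrafilter S),
    toFun (ult f μ) ≤ ult (toFun ∘ f) μ

namespace LeftUltrafunctor

variable {P Q R : Type u} [UltraPoset P] [UltraPoset Q] [UltraPoset R]

instance : FunLike (LeftUltrafunctor P Q) P Q where
  coe := toFun
  coe_injective _ _ h := LeftUltrafunctor.ext h

theorem monotone (φ : LeftUltrafunctor P Q) : Monotone φ := φ.monotone'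

theorem map_ult_le (φ : LeftUltrafunctor P Q) {S : Type u} (f : S → P) (μ : Ultrafilter S) :
    φ (ult f μ) ≤ ult (φ ∘ f) μ := φ.map_ult_le' f μ

/-- Left ultrafunctors are ordered pointwise. -/
instance : PartialOrder (LeftUltrafunctor P Q) := PartialOrder.lift _ DFunLike.coe_injective

/-- The identity left ultrafunctor. -/
def id (P : Type u) [UltraPoset P] : LeftUltrafunctor P P where
  toFun p := p
  monotone' := monotone_id
  map_ult_le' _ _ := le_rfl

/-- Composition of left ultrafunctors. -/
def comp (ψ : LeftUltrafunctor Q R) (φ : LeftUltrafunctor P Q) : LeftUltrafunctor P R where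
  toFun p := ψ (φ p)
  monotone' := ψ.monotone.comp φ.monotone
  map_ult_le' f μ := (ψ.monotone (φ.map_ult_le f μ)).trans (ψ.map_ult_le _ μ)

end LeftUltrafunctor

/-- The category of ultraposets and left ultrafunctors. -/
structure UltLPos where
  of ::
  carrier : Type u
  [str : UltraPoset carrier]

namespace UltLPos

attribute [instance] UltLPos.str

instance : CoeSort UltLPos.{u} (Type u) := ⟨UltLPos.carrier⟩

instance : Category UltLPos.{u} where
  Hom P Q := LeftUltrafunctor P Q
  id P := LeftUltrafunctor.id P
  comp φ ψ := ψ.comp φ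

instance (P Q : UltLPos.{u}) : PartialOrder (P ⟶ Q) :=
  inferInstanceAs (PartialOrder (LeftUltrafunctor P Q))

end UltLPos

/-- The poset `2 = {0 < 1}`, in an arbitrary universe. -/
abbrev Two : Type u := ULift.{u} Prop

/-- The ultrastructure on `2`: `⟨f, μ⟩ = i` iff `f⁻¹(i) ∈ μ`. -/
instance : UltraPoset Two.{u} where
  toPartialOrder := inferInstance
  ult f μ := ⟨∀ᶠ s in μ, (f s).down⟩
  ult_mono _ _ _ h := fun hf => hf.mono fun s hs => h s hs
  ult_pure _ _ := rfl
  ult_bind_le _ _ _ := fun h => h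
  ult_map _ _ _ _ := rfl

namespace LeftUltrafunctor

variable {P : Type u} [UltraPoset P]

/-- Joins of left ultrafunctors into `2` are pointwise. -/
instance : SupSet (LeftUltrafunctor P Two.{u}) where
  sSup T :=
    { toFun := fun p => ⟨∃ φ ∈ T, (φ p).down⟩
      monotone' := fun _ _ h ⟨φ, hT, hφ⟩ => ⟨φ, hT, φ.monotone h hφ⟩
      map_ult_le' := fun f μ ⟨φ, hT, hφ⟩ =>
        Filter.Eventually.mono (φ.map_ult_le f μ hφ) fun _ hs => ⟨φ, hT, hs⟩ }

/-- Finite meets of left ultrafunctors into `2` are pointwise. -/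
instance : Min (LeftUltrafunctor P Two.{u}) where
  min φ ψ :=
    { toFun := fun p => ⟨(φ p).down ∧ (ψ p).down⟩
      monotone' := fun _ _ h hp => ⟨φ.monotone h hp.1, ψ.monotone h hp.2⟩
      map_ult_le' := fun f μ h =>
        Filter.Eventually.and (φ.map_ult_le f μ h.1) (ψ.map_ult_le f μ h.2) }

instance : Top (LeftUltrafunctor P Two.{u}) where
  top :=
    { toFun := fun _ => ⟨True⟩
      monotone' := fun _ _ _ h => h
      map_ult_le' := fun _ _ _ => Filter.Eventually.of_forall fun _ => trivial }

instance : CompleteLattice (LeftUltrafunctor P Two.{u}) :=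
  { completeLatticeOfSup (LeftUltrafunctor P Two.{u}) (fun _ =>
      ⟨fun φ hφ _ h => ⟨φ, hφ, h⟩, fun _ hψ p ⟨_, hT, hφ⟩ => hψ hT p hφ⟩) with
    inf := fun φ ψ => min φ ψ
    inf_le_left := fun _ _ _ h => h.1
    inf_le_right := fun _ _ _ h => h.2
    le_inf := fun _ _ _ h₁ h₂ p h => ⟨h₁ p h, h₂ p h⟩
    top := ⊤
    le_top := fun _ _ _ => trivial }

/-- The poset of left ultrafunctors from `P` to `2` is a frame. -/
instance : Order.Frame (LeftUltrafunctor P Two.{u}) :=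
  Order.Frame.ofMinimalAxioms
    { inf_sSup_le_iSup_inf := fun φ T p h => by
        obtain ⟨h₁, ψ, hψ, h₂⟩ := h
        exact (le_iSup₂ (f := fun b (_ : b ∈ T) => φ ⊓ b) ψ hψ) p ⟨h₁, h₂⟩ }

/-- Precomposition with a left ultrafunctor is a frame homomorphism. -/
def precomp {Q : Type u} [UltraPoset Q] (φ : LeftUltrafunctor P Q) :
    FrameHom (LeftUltrafunctor Q Two.{u}) (LeftUltrafunctor P Two.{u}) where
  toFun ψ := ψ.comp φ
  map_inf' _ _ := rfl
  map_top' := rfl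
  map_sSup' _ := by
    refine le_antisymm (fun p ⟨ψ, hT, h⟩ => ⟨ψ.comp φ, ⟨ψ, hT, rfl⟩, h⟩) ?_
    rintro p ⟨_, ⟨ψ, hT, rfl⟩, h⟩
    exact ⟨ψ, hT, h⟩

end LeftUltrafunctor

/-- The functor `Ω : UltLPos → Loc`, sending `P` to the frame of left ultrafunctors `P → 2` and
`φ` to the localic map whose inverse image is precomposition with `φ`. -/
def ultOmega : UltLPos.{u} ⥤ Locale.{u} where
  obj P := Locale.of (LeftUltrafunctor P Two.{u})
  map φ := Quiver.Hom.op (Frm.ofHom (LeftUltrafunctor.precomp φ))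

/-- The inverse image of a localic map. -/
def localeInv {L M : Locale.{u}} (g : L ⟶ M) : FrameHom M L :=
  Frm.Hom.hom (Quiver.Hom.unop g)

/-- Localic maps are ordered by the pointwise order of their inverse images. -/
instance (L M : Locale.{u}) : PartialOrder (L ⟶ M) :=
  PartialOrder.lift localeInv fun _ _ h => Quiver.Hom.unop_inj (Frm.hom_ext h)

/-- A frame is coherent if every element is a join of finite (compact) elements and the finite
elements form a sublattice (closure under finite joins being automatic). -/
class IsCoherentFrame (L : Type u) [Order.Frame L] : Prop extends IsCompactlyGenerated L where
  isCompactElement_top : IsCompactElement (⊤ : L)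
  isCompactElement_inf : ∀ a b : L,
    IsCompactElement a → IsCompactElement b → IsCompactElement (a ⊓ b)

/-- The category of coherent locales and all localic maps between them. -/
abbrev CLoc := ObjectProperty.FullSubcategory fun L : Locale.{u} => IsCoherentFrame L

section Points

variable {L : Type u} [Order.Frame L]

theorem point_iff [IsCompactlyGenerated L] (x : FrameHom L Prop) (u : L) :
    x u ↔ ∃ k, IsCompactElement k ∧ k ≤ u ∧ x k := by
  constructor
  · intro h
    rw [← sSup_compact_le_eq u, map_sSup, sSup_image] at h
    simp only [iSup_Prop_eq] at h
    obtain ⟨k, hk, h⟩ := h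
    exact ⟨k, hk.1, hk.2, h⟩
  · rintro ⟨k, -, hk, h⟩
    exact (OrderHomClass.mono x hk : x k ≤ x u) h

variable [IsCoherentFrame L]

/-- The ultraproduct of points of a coherent frame: the unique point whose value at each finite
element `k` is the ultraproduct in `2` of the values at `k` (see `ultPoint_iff`). In other words,
it is the pointwise ultraproduct of models of the distributive lattice of finite elements, carried
along the bijection of points of `L` with these models. -/
def ultPoint {S : Type u} (f : S → FrameHom L Prop) (μ : Ultrafilter S) : FrameHom L Prop where
  toFun u := ∃ k, IsCompactElement k ∧ k ≤ u ∧ ∀ᶠ s in μ, f s k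
  map_top' := by
    refine eq_true ⟨⊤, IsCoherentFrame.isCompactElement_top, le_rfl, .of_forall fun s => ?_⟩
    rw [map_top]
    trivial
  map_inf' a b := by
    refine propext ⟨?_, ?_⟩
    · rintro ⟨k, hk, hab, h⟩
      exact ⟨⟨k, hk, hab.trans inf_le_left, h⟩, ⟨k, hk, hab.trans inf_le_right, h⟩⟩
    · rintro ⟨⟨k, hk, ha, h⟩, ⟨k', hk', hb, h'⟩⟩
      refine ⟨k ⊓ k', IsCoherentFrame.isCompactElement_inf _ _ hk hk', inf_le_inf ha hb, ?_⟩
      filter_upwards [h, h'] with s hs hs'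
      rw [map_inf]
      exact ⟨hs, hs'⟩
  map_sSup' T := by
    refine propext ⟨?_, ?_⟩
    · rintro ⟨k, hk, hT, h⟩
      have hle : k ≤ sSup {c : L | IsCompactElement c ∧ ∃ u ∈ T, c ≤ u} := by
        refine hT.trans (sSup_le fun u hu => ?_)
        rw [← sSup_compact_le_eq u]
        exact sSup_le_sSup fun c hc => ⟨hc.1, u, hu, hc.2⟩
      obtain ⟨t, ht, hkt⟩ :=
        (CompleteLattice.isCompactElement_iff_exists_le_sSup_of_le_sSup (k := k)).1 hk _ hle
      have h' : (⋃ c ∈ (t : Set L), {s | f s c}) ∈ μ := by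
        filter_upwards [h] with s hs
        have h₁ : f s (t.sup id) := (OrderHomClass.mono (f s) hkt : f s k ≤ _) hs
        rw [map_finset_sup, Finset.sup_eq_iSup] at h₁
        simpa using h₁
      obtain ⟨c, hc, hcμ⟩ := (Ultrafilter.finite_biUnion_mem_iff t.finite_toSet).1 h'
      obtain ⟨hcc, u, hu, hcu⟩ := ht hc
      exact ⟨_, ⟨u, hu, rfl⟩, c, hcc, hcu, hcμ⟩
    · rintro ⟨_, ⟨u, hu, rfl⟩, k, hk, hku, h⟩
      exact ⟨k, hk, hku.trans (le_sSup hu), h⟩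

theorem eventually_of_ultPoint {S : Type u} {f : S → FrameHom L Prop} {μ : Ultrafilter S} {u : L}
    (h : ultPoint f μ u) : ∀ᶠ s in μ, f s u := by
  obtain ⟨k, -, hle, h⟩ := h
  exact h.mono fun s hs => (OrderHomClass.mono (f s) hle : f s k ≤ f s u) hs

theorem ultPoint_iff {S : Type u} (f : S → FrameHom L Prop) (μ : Ultrafilter S) {k : L}
    (hk : IsCompactElement k) : ultPoint f μ k ↔ ∀ᶠ s in μ, f s k :=
  ⟨eventually_of_ultPoint, fun h => ⟨k, hk, le_rfl, h⟩⟩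

/-- The ultraposet of points of a coherent frame, ordered pointwise. -/
instance : UltraPoset (FrameHom L Prop) where
  toPartialOrder := inferInstance
  ult f μ := ultPoint f μ
  ult_mono _ _ _ h := fun _ ⟨k, hk, hku, hf⟩ => ⟨k, hk, hku, hf.mono fun s hs => h s k hs⟩
  ult_pure f s := by
    ext u
    exact (point_iff (f s) u).symm
  ult_bind_le _ _ _ := fun _ ⟨k, hk, hku, h⟩ =>
    ⟨k, hk, hku, Filter.Eventually.mono h fun _ ht => ⟨k, hk, le_rfl, ht⟩⟩
  ult_map _ _ _ _ := rfl

/-- A frame homomorphism `M → L` induces a left ultrafunctor from points of `L` to points of `M`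
by precomposition. -/
def pointMap {M : Type u} [Order.Frame M] [IsCoherentFrame M] (g : FrameHom M L) :
    LeftUltrafunctor (FrameHom L Prop) (FrameHom M Prop) where
  toFun x := x.comp g
  monotone' _ _ h := fun u => h (g u)
  map_ult_le' f μ := fun u h => by
    obtain ⟨k, hk, hku, h⟩ := (point_iff ((ultPoint f μ).comp g) u).1 h
    exact ⟨k, hk, hku, eventually_of_ultPoint (f := f) (u := g k) h⟩

end Points

instance (L : CLoc.{u}) : IsCoherentFrame L.obj := L.property

/-- The functor `pt : CLoc → UltLPos`, sending a coherent locale to its ultraposet of points. -/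
def cohPt : CLoc.{u} ⥤ UltLPos.{u} where
  obj L := UltLPos.of (FrameHom L.obj Prop)
  map g := pointMap (localeInv g.hom)

/-- The full subcategory of `UltLPos` on the essential image of `pt`. -/
abbrev CUltLPos := (cohPt.{u}).essImage.FullSubcategory

/-! Everything rests on `Ω (pt L) ≅ L`: a left ultrafunctor from the points of `L` to `2` is
evaluation at a unique element of `L`. The element is unique because a coherent frame has enough
points (`le_of_forall_point`). It exists because `φ` is locally constant upwards
(`exists_isCompactElement_of_leftUltrafunctor`): counterexamples on all compact neighbourhoods of
`x` would have an ultraproduct above `x`, against `φ` being lax. Swapping arguments turns left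
ultrafunctors `P → pt L` into frame homomorphisms `L → Ω P` (`transposePoint`). The case where `P`
is itself a space of points gives fullness of `pt`, and the equivalence follows formally. -/

section CoherentFrames

variable {L : Type u} [Order.Frame L]

/-- Compactness is invariant under order isomorphism. -/
theorem IsCompactElement.map_orderIso {M : Type u} [Order.Frame M] (e : L ≃o M) {k : L}
    (hk : IsCompactElement k) : IsCompactElement (e k) := by
  intro s v hs hd hv hkv
  obtain ⟨_, ⟨y, hy, rfl⟩, h⟩ := hk (e.symm '' s) (e.symm v) (hs.image _)
    (hd.mono_comp (g := e.symm) fun _ _ h => e.symm.monotone h)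
    (e.symm.isLUB_image'.2 hv) (e.le_symm_apply.2 hkv)
  exact ⟨y, hy, e.le_symm_apply.1 h⟩

/-- Coherence is invariant under order isomorphism. -/
theorem IsCoherentFrame.of_orderIso {M : Type u} [Order.Frame M] [IsCoherentFrame L]
    (e : L ≃o M) : IsCoherentFrame M where
  exists_sSup_eq v := by
    refine ⟨e '' {c | IsCompactElement c ∧ c ≤ e.symm v}, ?_, ?_⟩
    · rintro _ ⟨c, hc, rfl⟩
      exact hc.1.map_orderIso e
    · rw [sSup_image, ← e.map_sSup, sSup_compact_le_eq, e.apply_symm_apply]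
  isCompactElement_top := by
    rw [← e.map_top]
    exact IsCoherentFrame.isCompactElement_top.map_orderIso e
  isCompactElement_inf a b ha hb := by
    have h := IsCoherentFrame.isCompactElement_inf _ _
      (ha.map_orderIso e.symm) (hb.map_orderIso e.symm)
    simpa using h.map_orderIso e

/-! ### Enough points. -/

/-- An element maximal among those not above a given one determines a point of the frame. -/
def pointOfMaximal {k p : L} (hp : Maximal (fun q => ¬ k ≤ q) p) : FrameHom L Prop where
  toFun u := ¬ u ≤ p
  map_top' := eq_true fun h => hp.prop (le_top.trans h)
  map_inf' a b := by
    -- By maximality, anything strictly above `p` lies above `k`; distributivity then makes `p`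
    -- prime.
    have key : ∀ a, ¬ a ≤ p → k ≤ p ⊔ a := fun a ha => by
      by_contra h
      exact ha (le_sup_right.trans (hp.le_of_ge h le_sup_left))
    refine propext ⟨fun h => ⟨fun ha => h (inf_le_left.trans ha),
      fun hb => h (inf_le_right.trans hb)⟩, fun ⟨ha, hb⟩ h => hp.prop ?_⟩
    calc k ≤ (p ⊔ a) ⊓ (p ⊔ b) := le_inf (key a ha) (key b hb)
      _ = p ⊔ a ⊓ b := sup_inf_left _ _ _ |>.symm
      _ = p := sup_eq_left.2 h
  map_sSup' T := by
    simp [sSup_image, sSup_le_iff]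

/-- A compactly generated frame has enough points. -/
theorem le_of_forall_point [IsCompactlyGenerated L] {u v : L}
    (h : ∀ x : FrameHom L Prop, x u → x v) : u ≤ v := by
  rw [le_iff_compact_le_imp]
  intro k hk hku
  by_contra hkv
  obtain ⟨p, hvp, hp⟩ := zorn_le_nonempty₀ {q : L | ¬ k ≤ q} (fun c hc hchain y hy => by
    -- Compactness of `k`: if the supremum of the chain were above `k`, some member would be.
    refine ⟨sSup c, fun hks => ?_, fun z => le_sSup⟩
    obtain ⟨q, hq, hkq⟩ := hk c _ ⟨y, hy⟩ hchain.directedOn (isLUB_sSup c) hks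
    exact hc hq hkq) v hkv
  exact h (pointOfMaximal hp) (fun hup => hp.prop (hku.trans hup)) hvp

variable [IsCoherentFrame L]

/-! ### Left ultrafunctors into `2` as elements of the frame. -/

/-- Evaluation of points at an element of a coherent frame is a left ultrafunctor into `2`. -/
def evalPoint (u : L) : LeftUltrafunctor (FrameHom L Prop) Two.{u} where
  toFun x := ⟨x u⟩
  monotone' _ _ h := h u
  map_ult_le' _ _ := fun h => eventually_of_ultPoint h

/-- If a left ultrafunctor into `2` holds at a point `x`, then it holds at all points of some
basic compact open neighbourhood of `x`. -/
theorem exists_isCompactElement_of_leftUltrafunctor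
    (φ : LeftUltrafunctor (FrameHom L Prop) Two.{u}) {x : FrameHom L Prop} (hx : (φ x).down) :
    ∃ k, IsCompactElement k ∧ x k ∧ ∀ y : FrameHom L Prop, y k → (φ y).down := by
  by_contra! hcon
  -- The ultraproduct is indexed by the compact neighbourhoods of `x`, along an ultrafilter refining
  -- the filter of ever smaller ones.
  let S := {k : L // IsCompactElement k ∧ x k}
  choose y hy hφ using fun k : S => hcon k.1 k.2.1 k.2.2
  let top : S := ⟨⊤, IsCoherentFrame.isCompactElement_top, by rw [map_top]; trivial⟩
  have hdir : IsDirected S (· ≥ ·) := ⟨fun a b =>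
    ⟨⟨a.1 ⊓ b.1, IsCoherentFrame.isCompactElement_inf _ _ a.2.1 b.2.1, by
      rw [map_inf]; exact ⟨a.2.2, b.2.2⟩⟩, inf_le_left, inf_le_right⟩⟩
  have : Nonempty S := ⟨top⟩
  have : (Filter.atBot : Filter S).NeBot := Filter.atBot_neBot
  let μ : Ultrafilter S := Ultrafilter.of Filter.atBot
  -- For `k` in `S`, almost every `j` is below `k`, and `y j` holds at `j`, hence at `k`.
  have hle : x ≤ ult y μ := fun u hu => by
    obtain ⟨k, hk, hku, hxk⟩ := (point_iff x u).1 hu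
    refine ⟨k, hk, hku, ?_⟩
    filter_upwards [Ultrafilter.of_le _ (Filter.Iic_mem_atBot (⟨k, hk, hxk⟩ : S))] with j hj
    exact (OrderHomClass.mono (y j) hj : y j j.1 ≤ y j k) (hy j)
  obtain ⟨j, hj⟩ := Filter.Eventually.exists
    (φ.map_ult_le y μ (φ.monotone hle hx) : ∀ᶠ j in μ, (φ (y j)).down)
  exact hφ j hj

theorem evalPoint_surjective : Function.Surjective (evalPoint (L := L)) := by
  intro φ
  -- The join of `T` is the largest element whose evaluation is below `φ`.
  let T : Set L := {k | ∀ y : FrameHom L Prop, y k → (φ y).down}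
  refine ⟨sSup T, LeftUltrafunctor.ext (funext fun x => congrArg ULift.up (propext ⟨?_, ?_⟩))⟩
  · intro (h : x (sSup T))
    rw [map_sSup, sSup_image] at h
    simp only [iSup_Prop_eq] at h
    obtain ⟨k, hk, hxk⟩ := h
    exact hk x hxk
  · intro h
    obtain ⟨k, -, hxk, hk⟩ := exists_isCompactElement_of_leftUltrafunctor φ h
    exact (OrderHomClass.mono x (le_sSup hk) : x k ≤ x (sSup T)) hxk

theorem evalPoint_le_evalPoint {u v : L} : evalPoint u ≤ evalPoint v ↔ u ≤ v :=
  ⟨fun h => le_of_forall_point h, fun h x => OrderHomClass.mono x h⟩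

/-- A coherent frame is isomorphic to the frame of left ultrafunctors from its points to `2`. -/
noncomputable def evalPointIso : L ≃o LeftUltrafunctor (FrameHom L Prop) Two.{u} :=
  RelIso.ofSurjective ⟨⟨evalPoint, fun _ _ h => le_antisymm
    (evalPoint_le_evalPoint.1 h.le) (evalPoint_le_evalPoint.1 h.ge)⟩,
    evalPoint_le_evalPoint⟩ evalPoint_surjective

/-- `evalPoint` as a frame homomorphism. -/
def evalPointHom : FrameHom L (LeftUltrafunctor (FrameHom L Prop) Two.{u}) where
  toFun := evalPoint
  map_inf' := map_inf evalPointIso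
  map_top' := map_top evalPointIso
  map_sSup' := map_sSup evalPointIso

/-! ### Transposition between points and frame homomorphisms. -/

variable {P : Type u} [UltraPoset P]

/-- A left ultrafunctor from `P` to the points of `L` is the same as a frame homomorphism from `L`
to the frame of left ultrafunctors `P → 2`. -/
def transposePoint : LeftUltrafunctor P (FrameHom L Prop) ≃o
    FrameHom L (LeftUltrafunctor P Two.{u}) where
  toFun φ := φ.precomp.comp evalPointHom
  invFun g :=
    { toFun := fun p =>
        { toFun := fun u => (g u p).down
          map_top' := by rw [map_top]; exact eq_true trivial
          map_inf' := fun a b => by rw [map_inf]; rfl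
          map_sSup' := fun T => by
            rw [map_sSup]
            refine propext ⟨?_, ?_⟩
            · rintro ⟨_, ⟨u, hu, rfl⟩, h⟩
              exact ⟨_, ⟨u, hu, rfl⟩, h⟩
            · rintro ⟨_, ⟨u, hu, rfl⟩, h⟩
              exact ⟨_, ⟨u, hu, rfl⟩, h⟩ }
      monotone' := fun _ _ h u => (g u).monotone h
      map_ult_le' := fun f μ u (h : (g u (ult f μ)).down) => by
        -- Ultraproducts of points are computed on compact elements, so `u` is first replaced by a
        -- compact `k ≤ u`.
        rw [← sSup_compact_le_eq u, map_sSup] at h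
        obtain ⟨_, ⟨k, hk, rfl⟩, h⟩ := h
        exact ⟨k, hk.1, hk.2, (g k).map_ult_le f μ h⟩ }
  left_inv _ := rfl
  right_inv _ := rfl
  map_rel_iff' := ⟨fun h p u => h u p, fun h u p => h p u⟩

end CoherentFrames

/-! ### Passage to categories. -/

/-- Localic maps correspond contravariantly to frame homomorphisms. -/
def localeHomIso (L M : Locale.{u}) : FrameHom M L ≃o (L ⟶ M) where
  toFun g := Quiver.Hom.op (Frm.ofHom g)
  invFun := localeInv
  left_inv _ := rfl
  right_inv _ := rfl
  map_rel_iff' := Iff.rfl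

/-- The correspondence `UltLPos(P, pt L) ≅ Loc(Ω P, L)`, an isomorphism of posets. -/
def ultLPosHomIso (P : UltLPos.{u}) (L : CLoc.{u}) :
    (P ⟶ cohPt.obj L) ≃o (ultOmega.obj P ⟶ L.obj) :=
  (transposePoint (L := L.obj) (P := P)).trans (localeHomIso (ultOmega.obj P) L.obj)

/-- The locale of opens of the points of a coherent locale is that locale. -/
noncomputable def omegaPointIso (L : CLoc.{u}) : ultOmega.obj (cohPt.obj L) ≅ L.obj :=
  (Frm.Iso.mk (α := L.obj.unop) (β := Frm.of (LeftUltrafunctor (FrameHom L.obj Prop) Two.{u}))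
    evalPointIso).op

theorem cohPt_map_le_iff {L M : CLoc.{u}} (g h : L ⟶ M) :
    g.hom ≤ h.hom ↔ cohPt.map g ≤ cohPt.map h :=
  ⟨fun H (x : FrameHom L.obj Prop) u => OrderHomClass.mono x (H u),
    fun H u => le_of_forall_point (L := L.obj) fun x => H x u⟩

instance : cohPt.{u}.Faithful where
  map_injective {_ _ g h} H := ObjectProperty.hom_ext _ <| le_antisymm
    ((cohPt_map_le_iff g h).2 H.le) ((cohPt_map_le_iff h g).2 H.ge)

theorem ultLPosHomIso_cohPt_map {L M : CLoc.{u}} (g : L ⟶ M) :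
    ultLPosHomIso _ _ (cohPt.map g) = (omegaPointIso L).hom ≫ g.hom := rfl

/-- Under `Ω (pt L) ≅ L`, the transpose of `φ` becomes a localic map `L ⟶ M`, and this is the
preimage. -/
instance : cohPt.{u}.Full where
  map_surjective {L M} φ := by
    refine ⟨ObjectProperty.homMk ((omegaPointIso L).inv ≫ ultLPosHomIso _ _ φ),
      (ultLPosHomIso _ _).injective ?_⟩
    rw [ultLPosHomIso_cohPt_map]
    simp

theorem isCoherentFrame_ultOmega (P : CUltLPos.{u}) :
    IsCoherentFrame (ultOmega.obj P.obj) := by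
  obtain ⟨L, ⟨e⟩⟩ := P.property
  let i : L.obj ≅ ultOmega.obj P.obj := (omegaPointIso L).symm ≪≫ ultOmega.mapIso e
  -- Inverse images reverse direction, so the frame map out of `L` comes from `i.inv`.
  let f : FrameHom L.obj (ultOmega.obj P.obj) := localeInv i.inv
  let f' : FrameHom (ultOmega.obj P.obj) L.obj := localeInv i.hom
  have h₁ : ∀ a, f' (f a) = a := fun a =>
    DFunLike.congr_fun (congrArg localeInv i.hom_inv_id) a
  have h₂ : ∀ a, f (f' a) = a := fun a =>
    DFunLike.congr_fun (congrArg localeInv i.inv_hom_id) a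
  exact IsCoherentFrame.of_orderIso (L := L.obj) (OrderIso.ofHomInv f f'
    (OrderHom.ext _ _ (funext h₂)) (OrderHom.ext _ _ (funext h₁)))

/-- The restriction of `Ω` to a functor `CUltLPos → CLoc`. -/
def cohOmega : CUltLPos.{u} ⥤ CLoc.{u} :=
  ObjectProperty.lift (fun L : Locale.{u} => IsCoherentFrame L)
    (cohPt.essImage.ι ⋙ ultOmega) isCoherentFrame_ultOmega

/-- `Ω` is a retraction of `pt`, up to natural isomorphism. -/
noncomputable def cohPtCompOmega : cohPt.{u}.toEssImage ⋙ cohOmega ≅ 𝟭 CLoc.{u} :=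
  NatIso.ofComponents (fun L => ObjectProperty.isoMk _ (omegaPointIso L)) fun _ => rfl

instance : cohPt.{u}.toEssImage.IsEquivalence where

/-- The functors `pt` and `Ω` form an equivalence between `CLoc` and `CUltLPos`. -/
noncomputable def cohEquivalence : CLoc.{u} ≌ CUltLPos.{u} :=
  -- The chosen inverse `G` is replaced by `Ω` itself, via `G ≅ G ⋙ (pt ⋙ Ω) ≅ (G ⋙ pt) ⋙ Ω ≅ Ω`.
  cohPt.toEssImage.asEquivalence.changeInverse
    (Functor.isoWhiskerLeft cohPt.toEssImage.asEquivalence.inverse cohPtCompOmega.symm ≪≫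
      (Functor.associator _ _ _).symm ≪≫
      Functor.isoWhiskerRight cohPt.toEssImage.asEquivalence.counitIso cohOmega)

theorem mainTheorem1 :
    -- `Ω` restricts to a functor `CUltLPos → CLoc`, which together with `pt` is an equivalence
    (∃ h : ∀ P : CUltLPos.{u}, IsCoherentFrame (ultOmega.obj P.obj),
      ∃ e : CLoc.{u} ≌ CUltLPos.{u},
        e.functor = cohPt.toEssImage ∧
        e.inverse = ObjectProperty.lift (fun L : Locale.{u} => IsCoherentFrame L)
          (cohPt.essImage.ι ⋙ ultOmega) h) ∧
    -- `pt : CLoc → UltLPos` is fully faithful, also for the pointwise order on morphisms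
    cohPt.{u}.Full ∧ cohPt.{u}.Faithful ∧
    (∀ (L M : CLoc.{u}) (g h : L ⟶ M), g.hom ≤ h.hom ↔ cohPt.map g ≤ cohPt.map h) ∧
    -- `UltLPos(P, pt L) ≅ Loc(Ω P, L)` as posets, naturally in `P` and `L`
    (∃ θ : ∀ (P : UltLPos.{u}) (L : CLoc.{u}), (P ⟶ cohPt.obj L) ≃o (ultOmega.obj P ⟶ L.obj),
      (∀ (P P' : UltLPos.{u}) (L : CLoc.{u}) (α : P' ⟶ P) (φ : P ⟶ cohPt.obj L),
        θ P' L (α ≫ φ) = ultOmega.map α ≫ θ P L φ) ∧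
      (∀ (P : UltLPos.{u}) (L L' : CLoc.{u}) (g : L ⟶ L') (φ : P ⟶ cohPt.obj L),
        θ P L' (φ ≫ cohPt.map g) = θ P L φ ≫ g.hom)) := by
  exact ⟨⟨isCoherentFrame_ultOmega, cohEquivalence, rfl, rfl⟩, inferInstance, inferInstance,
    fun _ _ => cohPt_map_le_iff, ultLPosHomIso, fun _ _ _ _ _ => rfl, fun _ _ _ _ _ => rfl⟩
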